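/- Let $0<a<\epsilon<b$, $h>0$, $p\ge 0$, and let $\lambda,\mu$ be the Lamé constants $$\lambda=\frac{E\nu}{(1+\nu)(1-2\nu)},\qquad \mu=\frac{E}{2(1+\nu)},\qquad E>0,\quad \nu\in\left(-1,\tfrac12\right).$$ On the annulus $C_{a,b}=\{(x,y)\in\mathbb R^2: a^2<x^2+y^2<b^2\}$ let $\chi_p(x,y)=p$ if $a^2\le x^2+y^2<\epsilon^2$ and $\chi_p(x,y)=0$ if $\epsilon^2<x^2+y^2\le b^2$, and for $k\in\mathbb N$ let $$\Psi_k(x,y)=\begin{cases}(-1)^{\frac{k+1}{2}}\,\dfrac4h\,\chi_p(x,y) & \text{if } k \text{ is odd},\\ 0 & \text{if } k \text{ is even.}\end{cases}$$ Since $\Psi_k$ is radial, write $\Psi_k(\rho)$ for its value at distance $\rho$ from the origin. Then for every odd $k\ge 1$ the boundary value problem $$\begin{cases} Y_k''+\dfrac{Y_k'}{\rho}-\dfrac{Y_k}{\rho^2}-\dfrac{\mu}{\lambda+2\mu}\,\dfrac{\pi^2k^2}{h^2}\,Y_k+\dfrac{\lambda+\mu}{\lambda+2\mu}\,\dfrac{\pi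 k}{h}\,Z_k'=0 & \text{in }(a,b),\\[8pt] Z_k''+\dfrac{Z_k'}{\rho}-\dfrac{\lambda+2\mu}{\mu}\,\dfrac{\pi^2k^2}{h^2}\,Z_k-\dfrac{\lambda+\mu}{\mu}\,\dfrac{\pi k}{h}\left[Y_k'+\dfrac{Y_k}{\rho}\right]=-\dfrac1\mu\,\Psi_k(\rho) & \text{in }(a,b),\\[8pt] (\lambda+2\mu)Y_k'(\rho)+\dfrac{\lambda}{\rho}\,Y_k(\rho)+\lambda\,\dfrac{\pi k}{h}\,Z_k(\rho)=0, & \rho\in\{a,b\},\\[8pt] Z_k'(\rho)-\dfrac{\pi k}{h}\,Y_k(\rho)=0, & \rho\in\{a,b\}, \end{cases}$$ has a unique solution $(Y_k,Z_k)\in H^1(a,b;\mathbb R^2)$. Here derivatives are weak derivatives, the two equations hold almost everywhere in $(a,b)$, and the boundary conditions are understood for the representatives of $Y_k,Z_k,Y_k',Z_k'$ that are continuous on $[a,b]$. -/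

import Mathlib

open MeasureTheory Set
open scoped ContDiff

noncomputable section

/-- First Lamé constant in terms of the Young modulus `E` and the Poisson ratio `ν`. -/
def lameLambda (E ν : ℝ) : ℝ := E * ν / ((1 + ν) * (1 - 2 * ν))

/-- Second Lamé constant in terms of the Young modulus `E` and the Poisson ratio `ν`. -/
def lameMu (E ν : ℝ) : ℝ := E / (2 * (1 + ν))

/-- The load density `χ_p` on the annulus `a² < x² + y² < b²`: it is `p` where
`a² ≤ x² + y² < ε²` and `0` where `ε² < x² + y² ≤ b²` (the value `0` is also taken on the
null set `x² + y² = ε²` and outside the closed annulus). -/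
def chiLoad (a ε p : ℝ) (x y : ℝ) : ℝ :=
  open Classical in if a ^ 2 ≤ x ^ 2 + y ^ 2 ∧ x ^ 2 + y ^ 2 < ε ^ 2 then p else 0

/-- The forcing term `Ψ_k` on the annulus. -/
def PsiForce (a ε p h : ℝ) (k : ℕ) (x y : ℝ) : ℝ :=
  open Classical in if Odd k then (-1) ^ ((k + 1) / 2) * (4 / h) * chiLoad a ε p x y else 0

/-- `Ψ_k` is a radial function; `PsiRadial … ρ` is its value at distance `ρ` from the origin. -/
def PsiRadial (a ε p h : ℝ) (k : ℕ) (ρ : ℝ) : ℝ := PsiForce a ε p h k ρ 0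

theorem PsiForce_eq_PsiRadial (a ε p h : ℝ) (k : ℕ) (x y : ℝ) :
    PsiForce a ε p h k x y = PsiRadial a ε p h k (Real.sqrt (x ^ 2 + y ^ 2)) := by
  have e : Real.sqrt (x ^ 2 + y ^ 2) ^ 2 = x ^ 2 + y ^ 2 := Real.sq_sqrt (by positivity)
  simp [PsiRadial, PsiForce, chiLoad, e]

/-- `v` is the weak (distributional) derivative of `u` on the interval `(a, b)`. -/
def HasWeakDerivOn (a b : ℝ) (u v : ℝ → ℝ) : Prop :=
  LocallyIntegrableOn u (Ioo a b) ∧ LocallyIntegrableOn v (Ioo a b) ∧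
    ∀ φ : ℝ → ℝ, ContDiff ℝ ∞ φ → HasCompactSupport φ → tsupport φ ⊆ Ioo a b →
      ∫ x in Ioo a b, u x * deriv φ x = -∫ x in Ioo a b, v x * φ x

/-- The space `L²(a, b)` of classes of functions modulo equality almost everywhere. -/
abbrev L2Interval (a b : ℝ) : Type := Lp ℝ 2 (volume.restrict (Ioo a b))

/-- The Sobolev space `H¹(a, b)`: classes in `L²(a, b)` with a weak derivative in `L²(a, b)`. -/
def H1Interval (a b : ℝ) : Set (L2Interval a b) :=
  {u | ∃ v : L2Interval a b, HasWeakDerivOn a b u v}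

/-- `f` is the representative of `u` (a function defined almost everywhere on `(a, b)`) that is
continuous on `[a, b]`; `f a` and `f b` are then the boundary values of `u`. -/
def IsContRepOn (a b : ℝ) (u f : ℝ → ℝ) : Prop :=
  ContinuousOn f (Icc a b) ∧ ∀ᵐ x ∂(volume.restrict (Ioo a b)), u x = f x

/-- `(Y, Z)` solves the radial boundary value problem on `(a, b)` with forcing `Ψ`.
The functions `Y₁, Z₁` are the first and `Y₂, Z₂` the second weak derivatives of `Y, Z`; the two
equations hold almost everywhere on `(a, b)`. As `Y, Y₁, Z, Z₁` have weak derivatives, the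
boundary conditions at `ρ = a` and `ρ = b` are imposed on their continuous representatives
(those of `Y, Z` are `Y₀, Z₀`; `Y₁, Z₁` are themselves chosen continuous). -/
def IsRadialSolution (a b h lam mu : ℝ) (k : ℕ) (Ψ : ℝ → ℝ) (Y Z : ℝ → ℝ) : Prop :=
  ∃ Y₀ Y₁ Y₂ Z₀ Z₁ Z₂ : ℝ → ℝ,
    IsContRepOn a b Y Y₀ ∧ IsContRepOn a b Z Z₀ ∧
    ContinuousOn Y₁ (Icc a b) ∧ ContinuousOn Z₁ (Icc a b) ∧
    HasWeakDerivOn a b Y Y₁ ∧ HasWeakDerivOn a b Y₁ Y₂ ∧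
    HasWeakDerivOn a b Z Z₁ ∧ HasWeakDerivOn a b Z₁ Z₂ ∧
    (∀ᵐ ρ ∂(volume.restrict (Ioo a b)),
      Y₂ ρ + Y₁ ρ / ρ - Y ρ / ρ ^ 2
        - mu / (lam + 2 * mu) * (Real.pi ^ 2 * (k : ℝ) ^ 2 / h ^ 2) * Y ρ
        + (lam + mu) / (lam + 2 * mu) * (Real.pi * (k : ℝ) / h) * Z₁ ρ = 0) ∧
    (∀ᵐ ρ ∂(volume.restrict (Ioo a b)),
      Z₂ ρ + Z₁ ρ / ρ
        - (lam + 2 * mu) / mu * (Real.pi ^ 2 * (k : ℝ) ^ 2 / h ^ 2) * Z ρ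
        - (lam + mu) / mu * (Real.pi * (k : ℝ) / h) * (Y₁ ρ + Y ρ / ρ) = -(1 / mu) * Ψ ρ) ∧
    (∀ ρ ∈ ({a, b} : Set ℝ),
      (lam + 2 * mu) * Y₁ ρ + lam / ρ * Y₀ ρ + lam * (Real.pi * (k : ℝ) / h) * Z₀ ρ = 0) ∧
    (∀ ρ ∈ ({a, b} : Set ℝ), Z₁ ρ - Real.pi * (k : ℝ) / h * Y₀ ρ = 0)

end

/-! Put κ = πk/h. Uniqueness is an energy argument from linear elasticity. With the stresses σ =
(λ+2μ)Y' + λY/ρ + λκZ and τ = μ(Z' - κY), the function Φ = ρ(σY + τZ) has, along homogeneous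
solutions, a derivative equal to ρ times a quadratic form in the strains, positive definite because
μ > 0 and 3λ+2μ > 0. The boundary conditions say σ = τ = 0 at a and b, so Φ vanishes there; hence
the form vanishes and Y = Z = 0 (`eq_zero_of_homogeneous_radial_bvp`). Weak solutions reduce to this
case: the forcing cancels in a difference, whose weak derivatives are then classical by du
Bois-Reymond (`HasWeakDerivOn.hasDerivAt`).

Existence follows from uniqueness by shooting. A Volterra resolvent
(`exists_linear_volterra_resolvent`) solves the first-order system for (Y, Z, Y', Z') from any
initial data. The map from the four data to the four boundary expressions is linear and injective,
hence surjective, so suitable data cancel the boundary defect of a particular solution. -/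

/-! ### Weak derivatives on an interval and the du Bois-Reymond lemma -/

theorem integrable_mul_of_locallyIntegrableOn {a b : ℝ} {u φ : ℝ → ℝ}
    (hu : LocallyIntegrableOn u (Ioo a b)) (hφ : Continuous φ) (hc : HasCompactSupport φ)
    (hs : tsupport φ ⊆ Ioo a b) : Integrable (fun x => u x * φ x) := by
  have h1 : IntegrableOn u (tsupport φ) := hu.integrableOn_compact_subset hs hc
  have h2 : IntegrableOn (fun x => u x * φ x) (tsupport φ) :=
    h1.mul_continuousOn hφ.continuousOn hc
  refine (integrableOn_iff_integrable_of_support_subset ?_).1 h2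
  intro x hx
  exact subset_tsupport _ (right_ne_zero_of_mul hx)

theorem HasCompactSupport.tsupport_deriv_subset {φ : ℝ → ℝ} {s : Set ℝ} (hs : tsupport φ ⊆ s) :
    tsupport (deriv φ) ⊆ s :=
  (closure_minimal (support_deriv_subset) (isClosed_tsupport φ)).trans hs

/-- Serves to pass between `Lp` classes and continuous representatives, and to replace a second weak
derivative by its value from the equation. -/
theorem HasWeakDerivOn.congr_ae {a b : ℝ} {u u' v v' : ℝ → ℝ} (h : HasWeakDerivOn a b u v)
    (hu : u =ᵐ[volume.restrict (Ioo a b)] u') (hv : v =ᵐ[volume.restrict (Ioo a b)] v') :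
    HasWeakDerivOn a b u' v' := by
  have key : ∀ {f g : ℝ → ℝ}, f =ᵐ[volume.restrict (Ioo a b)] g →
      LocallyIntegrableOn f (Ioo a b) → LocallyIntegrableOn g (Ioo a b) := by
    intro f g hfg hf
    rw [locallyIntegrableOn_iff isOpen_Ioo.isLocallyClosed] at hf ⊢
    intro k hk hkc
    exact (hf k hk hkc).congr (ae_mono (Measure.restrict_mono hk le_rfl) hfg)
  refine ⟨key hu h.1, key hv h.2.1, fun φ h1 h2 h3 => ?_⟩
  have e1 : ∫ x in Ioo a b, u' x * deriv φ x = ∫ x in Ioo a b, u x * deriv φ x :=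
    integral_congr_ae (by filter_upwards [hu] with x hx; rw [hx])
  have e2 : ∫ x in Ioo a b, v' x * φ x = ∫ x in Ioo a b, v x * φ x :=
    integral_congr_ae (by filter_upwards [hv] with x hx; rw [hx])
  rw [e1, e2, h.2.2 φ h1 h2 h3]

theorem HasWeakDerivOn.sub {a b : ℝ} {u u' v v' : ℝ → ℝ} (h : HasWeakDerivOn a b u v)
    (h' : HasWeakDerivOn a b u' v') :
    HasWeakDerivOn a b (fun x => u x - u' x) (fun x => v x - v' x) := by
  refine ⟨h.1.sub h'.1, h.2.1.sub h'.2.1, fun φ h1 h2 h3 => ?_⟩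
  have c1 : Continuous (deriv φ) := h1.continuous_deriv (by simp)
  have c2 := h2.deriv
  have c3 := HasCompactSupport.tsupport_deriv_subset h3
  simp only [sub_mul]
  rw [integral_sub (integrable_mul_of_locallyIntegrableOn h.1 c1 c2 c3).integrableOn
      (integrable_mul_of_locallyIntegrableOn h'.1 c1 c2 c3).integrableOn,
    integral_sub (integrable_mul_of_locallyIntegrableOn h.2.1 h1.continuous h2 h3).integrableOn
      (integrable_mul_of_locallyIntegrableOn h'.2.1 h1.continuous h2 h3).integrableOn,
    h.2.2 φ h1 h2 h3, h'.2.2 φ h1 h2 h3]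
  ring

/-- A function which is continuous on `[a, b]` and differentiable off a countable set, with
integrable derivative, is weakly differentiable. -/
theorem hasWeakDerivOn_of_hasDerivAt {a b : ℝ} (hab : a < b) {u v : ℝ → ℝ} {s : Set ℝ}
    (hs : s.Countable) (hu : ContinuousOn u (Icc a b))
    (hd : ∀ x ∈ Ioo a b \ s, HasDerivAt u (v x) x) (hv : IntegrableOn v (Icc a b)) :
    HasWeakDerivOn a b u v := by
  have hui : IntegrableOn u (Icc a b) := hu.integrableOn_Icc
  refine ⟨(hui.mono_set Ioo_subset_Icc_self).locallyIntegrableOn,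
    (hv.mono_set Ioo_subset_Icc_self).locallyIntegrableOn, fun φ h1 h2 h3 => ?_⟩
  have cd : Continuous (deriv φ) := h1.continuous_deriv (by simp)
  have i1 : IntegrableOn (fun x => v x * φ x) (Icc a b) :=
    hv.mul_continuousOn h1.continuous.continuousOn isCompact_Icc
  have i2 : IntegrableOn (fun x => u x * deriv φ x) (Icc a b) :=
    hui.mul_continuousOn cd.continuousOn isCompact_Icc
  have hφa : φ a = 0 := image_eq_zero_of_notMem_tsupport fun hx => (h3 hx).1.ne rfl
  have hφb : φ b = 0 := image_eq_zero_of_notMem_tsupport fun hx => (h3 hx).2.ne rfl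
  have key := MeasureTheory.integral_eq_of_hasDerivAt_off_countable_of_le
    (fun x => u x * φ x) (fun x => v x * φ x + u x * deriv φ x) hab.le hs
    (hu.mul h1.continuous.continuousOn)
    (fun x hx => (hd x hx).mul (h1.differentiable (by simp) x).hasDerivAt)
    ((intervalIntegrable_iff_integrableOn_Icc_of_le hab.le).2 (i1.add i2))
  rw [intervalIntegral.integral_of_le hab.le, integral_Ioc_eq_integral_Ioo,
    integral_add (i1.mono_set Ioo_subset_Icc_self) (i2.mono_set Ioo_subset_Icc_self),
    hφa, hφb] at key
  linarith

theorem exists_Icc_of_isCompact_subset_Ioo {a b : ℝ} (hab : a < b) {K : Set ℝ} (hK : IsCompact K)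
    (hs : K ⊆ Ioo a b) : ∃ c d, a < c ∧ d < b ∧ K ⊆ Icc c d := by
  rcases K.eq_empty_or_nonempty with rfl | hne
  · exact ⟨b, a, hab, hab, empty_subset _⟩
  · refine ⟨sInf K, sSup K, (hs (hK.sInf_mem hne)).1, (hs (hK.sSup_mem hne)).2, fun x hx => ?_⟩
    exact ⟨csInf_le hK.bddBelow hx, le_csSup hK.bddAbove hx⟩

/-- A test function on `(a, b)` with vanishing integral is the derivative of a test function. -/
theorem exists_primitive_of_integral_eq_zero {a b : ℝ} (hab : a < b) {θ : ℝ → ℝ}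
    (h1 : ContDiff ℝ ∞ θ) (h2 : HasCompactSupport θ) (h3 : tsupport θ ⊆ Ioo a b)
    (h0 : ∫ x, θ x = 0) :
    ∃ φ : ℝ → ℝ, ContDiff ℝ ∞ φ ∧ HasCompactSupport φ ∧ tsupport φ ⊆ Ioo a b ∧ deriv φ = θ := by
  obtain ⟨c, d, hac, hdb, hcd⟩ := exists_Icc_of_isCompact_subset_Ioo hab h2 h3
  have hz : ∀ x, x ∉ Icc c d → θ x = 0 := fun x hx =>
    image_eq_zero_of_notMem_tsupport fun h => hx (hcd h)
  have hd : ∀ x, HasDerivAt (fun x => ∫ t in a..x, θ t) (θ x) x := fun x =>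
    intervalIntegral.integral_hasDerivAt_right (h1.continuous.intervalIntegrable _ _)
      h1.continuous.stronglyMeasurable.stronglyMeasurableAtFilter h1.continuous.continuousAt
  have hderiv : deriv (fun x => ∫ t in a..x, θ t) = θ := funext fun x => (hd x).deriv
  -- Left of `c` the integrand vanishes between `a` and `x`; right of `d` the primitive has reached
  -- the total integral, which is zero.
  have hsupp : Function.support (fun x => ∫ t in a..x, θ t) ⊆ Icc c d := by
    intro x hx
    by_contra hxn
    apply hx
    show ∫ t in a..x, θ t = 0
    rw [mem_Icc, not_and_or, not_le, not_le] at hxn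
    rcases hxn with hxc | hxd
    · rw [intervalIntegral.integral_congr (g := fun _ => (0 : ℝ))]
      · simp
      · intro t ht
        refine hz t fun h => ?_
        have := ht.2
        rcases le_total a x with h' | h' <;> simp [h'] at this <;> linarith [h.1]
    · have e : ∫ t in a..x, θ t = ∫ t, θ t := by
        apply intervalIntegral.integral_eq_integral_of_support_subset
        intro t ht
        have : t ∈ Icc c d := by
          by_contra hn
          exact ht (hz t hn)
        exact ⟨hac.trans_le this.1, this.2.trans hxd.le⟩
      rw [e, h0]
  have hts : tsupport (fun x => ∫ t in a..x, θ t) ⊆ Icc c d := closure_minimal hsupp isClosed_Icc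
  refine ⟨fun x => ∫ t in a..x, θ t, ?_, isCompact_Icc.of_isClosed_subset (isClosed_tsupport _) hts,
    fun x hx => ⟨hac.trans_le (hts hx).1, (hts hx).2.trans_lt hdb⟩, hderiv⟩
  rw [contDiff_infty_iff_deriv, hderiv]
  exact ⟨fun x => (hd x).differentiableAt, h1⟩

theorem exists_test_integral_eq_one {a b : ℝ} (hab : a < b) :
    ∃ η : ℝ → ℝ, ContDiff ℝ ∞ η ∧ HasCompactSupport η ∧ tsupport η ⊆ Ioo a b ∧ ∫ x, η x = 1 := by
  let f : ContDiffBump ((a + b) / 2) := ⟨(b - a) / 8, (b - a) / 4, by linarith, by linarith⟩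
  refine ⟨f.normed volume, f.contDiff_normed, f.hasCompactSupport_normed, ?_, f.integral_normed⟩
  rw [f.tsupport_normed_eq, Real.closedBall_eq_Icc]
  intro x hx
  have h1 := hx.1
  have h2 := hx.2
  simp only [f] at h1 h2
  constructor <;> linarith

/-- **Du Bois-Reymond lemma**: a continuous function with vanishing weak derivative is constant. -/
theorem HasWeakDerivOn.exists_eq_const {a b : ℝ} (hab : a < b) {w : ℝ → ℝ}
    (hw : ContinuousOn w (Icc a b)) (h : HasWeakDerivOn a b w (fun _ => 0)) :
    ∃ c, ∀ x ∈ Ioo a b, w x = c := by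
  obtain ⟨η, e1, e2, e3, e4⟩ := exists_test_integral_eq_one hab
  set c := ∫ x in Ioo a b, w x * η x with hc
  refine ⟨c, ?_⟩
  have hwc : ContinuousOn (fun x => w x - c) (Ioo a b) :=
    (hw.mono Ioo_subset_Icc_self).sub continuousOn_const
  have hloc : LocallyIntegrableOn (fun x => w x - c) (Ioo a b) :=
    hwc.locallyIntegrableOn measurableSet_Ioo
  -- Subtracting `(∫ ψ) η` from a test function `ψ` leaves mean zero, hence a derivative `φ'`.
  -- Testing with `φ` gives `∫ w ψ = c ∫ ψ`, so `w - c` annihilates every `ψ`.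
  have hae := isOpen_Ioo.ae_eq_zero_of_integral_contDiff_smul_eq_zero hloc (fun ψ p1 p2 p3 => by
    have q1 : ContDiff ℝ ∞ (fun x => ψ x - (∫ y, ψ y) * η x) := p1.sub (contDiff_const.mul e1)
    have q0 : tsupport (fun x => ψ x - (∫ y, ψ y) * η x) ⊆ tsupport ψ ∪ tsupport η := by
      refine closure_minimal (fun x hx => ?_) ((isClosed_tsupport _).union (isClosed_tsupport _))
      by_contra hn
      rw [mem_union, not_or] at hn
      apply hx
      simp [image_eq_zero_of_notMem_tsupport hn.1, image_eq_zero_of_notMem_tsupport hn.2]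
    have q2 : HasCompactSupport (fun x => ψ x - (∫ y, ψ y) * η x) :=
      (p2.isCompact.union e2.isCompact).of_isClosed_subset (isClosed_tsupport _) q0
    have q3 := q0.trans (union_subset p3 e3)
    have q4 : ∫ x, (ψ x - (∫ y, ψ y) * η x) = 0 := by
      rw [integral_sub (p1.continuous.integrable_of_hasCompactSupport p2)
        ((e1.continuous.integrable_of_hasCompactSupport e2).const_mul _), integral_const_mul, e4]
      ring
    obtain ⟨φ, f1, f2, f3, f4⟩ := exists_primitive_of_integral_eq_zero hab q1 q2 q3 q4
    have := h.2.2 φ f1 f2 f3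
    have iψ := integrable_mul_of_locallyIntegrableOn h.1 p1.continuous p2 p3
    have iη := integrable_mul_of_locallyIntegrableOn h.1 e1.continuous e2 e3
    have hfull : ∫ x in Ioo a b, w x * ψ x = ∫ x, w x * ψ x := by
      apply setIntegral_eq_integral_of_forall_compl_eq_zero
      intro x hx
      rw [image_eq_zero_of_notMem_tsupport fun hm => hx (p3 hm), mul_zero]
    rw [f4] at this
    have e5 : ∫ x in Ioo a b, w x * (ψ x - (∫ y, ψ y) * η x)
        = (∫ x in Ioo a b, w x * ψ x) - (∫ y, ψ y) * c := by
      rw [hc, ← integral_const_mul, ← integral_sub iψ.integrableOn (iη.integrableOn.const_mul _)]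
      congr 1
      ext x
      ring
    rw [e5] at this
    simp only [zero_mul, integral_zero, neg_zero] at this
    rw [hfull] at this
    have e6 : ∫ x, ψ x • (w x - c) = (∫ x, w x * ψ x) - (∫ y, ψ y) * c := by
      rw [← integral_mul_const, ← integral_sub iψ
        ((p1.continuous.integrable_of_hasCompactSupport p2).mul_const _)]
      congr 1
      ext x
      simp only [smul_eq_mul]
      ring
    rw [e6, this])
  have hae' : (fun x => w x - c) =ᵐ[volume.restrict (Ioo a b)] fun _ => 0 :=
    (ae_restrict_iff' measurableSet_Ioo).2 hae
  intro x hx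
  have := Measure.eqOn_open_of_ae_eq hae' isOpen_Ioo hwc continuousOn_const hx
  exact sub_eq_zero.1 this

/-- A continuous function whose weak derivative is continuous is classically differentiable. -/
theorem HasWeakDerivOn.hasDerivAt {a b : ℝ} (hab : a < b) {u g : ℝ → ℝ}
    (hu : ContinuousOn u (Icc a b)) (hg : ContinuousOn g (Icc a b)) (h : HasWeakDerivOn a b u g) :
    ∀ x ∈ Ioo a b, HasDerivAt u (g x) x := by
  -- Constant extension beyond the endpoints makes the primitive of `G` differentiable everywhere;
  -- `u` minus this primitive has zero weak derivative, so it is constant.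
  set G : ℝ → ℝ := IccExtend hab.le ((Icc a b).domRestrict g) with hG
  have hGc : Continuous G := (continuousOn_iff_continuous_domRestrict.1 hg).Icc_extend'
  have hGe : ∀ x ∈ Icc a b, G x = g x := fun x hx => by
    rw [hG, IccExtend_of_mem hab.le _ hx]; rfl
  have hd : ∀ x, HasDerivAt (fun x => ∫ t in a..x, G t) (G x) x := fun x =>
    intervalIntegral.integral_hasDerivAt_right (hGc.intervalIntegrable _ _)
      hGc.stronglyMeasurable.stronglyMeasurableAtFilter hGc.continuousAt
  have hcont : Continuous (fun x => ∫ t in a..x, G t) :=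
    continuous_iff_continuousAt.2 fun x => (hd x).continuousAt
  have hwG : HasWeakDerivOn a b (fun x => ∫ t in a..x, G t) G :=
    hasWeakDerivOn_of_hasDerivAt hab countable_empty hcont.continuousOn (fun x _ => hd x)
      hGc.continuousOn.integrableOn_Icc
  have hgG : (fun x => g x - G x) =ᵐ[volume.restrict (Ioo a b)] fun _ => 0 := by
    filter_upwards [ae_restrict_mem measurableSet_Ioo] with x hx
    rw [hGe x (Ioo_subset_Icc_self hx), sub_self]
  obtain ⟨c, hc⟩ := ((h.sub hwG).congr_ae Filter.EventuallyEq.rfl hgG).exists_eq_const hab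
    (hu.sub hcont.continuousOn)
  intro x hx
  have h1 : HasDerivAt (fun x => (∫ t in a..x, G t) + c) (g x) x := by
    rw [← hGe x (Ioo_subset_Icc_self hx)]
    exact (hd x).add_const c
  refine h1.congr_of_eventuallyEq ?_
  filter_upwards [isOpen_Ioo.mem_nhds hx] with y hy
  have := hc y hy
  simp only [Pi.sub_apply] at this
  linarith

/-! ### Linear Volterra integral equations -/

theorem continuous_volterra_integrand {E : Type*} [NormedAddCommGroup E] [NormedSpace ℝ E]
    {a b : ℝ} (hab : a ≤ b) {A : ℝ → E →L[ℝ] E} (hA : Continuous A) (u : C(Icc a b, E)) :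
    Continuous fun s => A s (u (projIcc a b hab s)) :=
  hA.clm_apply (u.continuous.comp continuous_projIcc)

theorem continuous_volterra_integral {E : Type*} [NormedAddCommGroup E] [NormedSpace ℝ E]
    {a b : ℝ} (hab : a ≤ b) {A : ℝ → E →L[ℝ] E} (hA : Continuous A) (u : C(Icc a b, E)) :
    Continuous fun t => ∫ s in a..t, A s (u (projIcc a b hab s)) :=
  intervalIntegral.continuous_primitive
    (fun _ _ => (continuous_volterra_integrand hab hA u).intervalIntegrable _ _) a

/-- The Volterra operator `u ↦ ∫ₐᵗ A(s) u(s) ds` as a linear map on `C([a, b], E)`. -/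
noncomputable def volterraLinear {E : Type*} [NormedAddCommGroup E] [NormedSpace ℝ E]
    {a b : ℝ} (hab : a ≤ b) (A : ℝ → E →L[ℝ] E) (hA : Continuous A) :
    C(Icc a b, E) →ₗ[ℝ] C(Icc a b, E) where
  toFun u := ⟨fun t => ∫ s in a..(t : ℝ), A s (u (projIcc a b hab s)),
    (continuous_volterra_integral hab hA u).comp continuous_subtype_val⟩
  map_add' u v := by
    ext t
    simp only [ContinuousMap.add_apply, map_add, ContinuousMap.coe_mk]
    exact intervalIntegral.integral_add
      ((continuous_volterra_integrand hab hA u).intervalIntegrable _ _)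
      ((continuous_volterra_integrand hab hA v).intervalIntegrable _ _)
  map_smul' c u := by
    ext t
    simp only [ContinuousMap.smul_apply, map_smul, ContinuousMap.coe_mk, RingHom.id_apply]
    exact intervalIntegral.integral_smul c _

/-- Integrating the power `(s - a) ^ n` gains the factor `1 / (n + 1)`; iteration turns these
factors into the factorial below. -/
theorem norm_volterraLinear_apply_le {E : Type*} [NormedAddCommGroup E] [NormedSpace ℝ E]
    {a b : ℝ} (hab : a ≤ b) {A : ℝ → E →L[ℝ] E} (hA : Continuous A) {M : ℝ}
    (hM : ∀ s ∈ Icc a b, ‖A s‖ ≤ M) {u : C(Icc a b, E)} {B : ℝ} {n : ℕ}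
    (hu : ∀ t : Icc a b, ‖u t‖ ≤ B * ((t : ℝ) - a) ^ n) (t : Icc a b) :
    ‖volterraLinear hab A hA u t‖ ≤ M * B / (n + 1) * ((t : ℝ) - a) ^ (n + 1) := by
  have h1 : ‖∫ s in a..(t : ℝ), A s (u (projIcc a b hab s))‖
      ≤ ∫ s in a..(t : ℝ), M * (B * (s - a) ^ n) := by
    refine intervalIntegral.norm_integral_le_of_norm_le t.2.1 (ae_of_all _ fun s hs => ?_) ?_
    · have hs' : s ∈ Icc a b := ⟨hs.1.le, hs.2.trans t.2.2⟩
      have := hu (projIcc a b hab s)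
      rw [projIcc_of_mem hab hs'] at this ⊢
      exact ((A s).le_opNorm _).trans
        (mul_le_mul (hM s hs') this (norm_nonneg _) ((norm_nonneg _).trans (hM s hs')))
    · exact Continuous.intervalIntegrable (by fun_prop) _ _
  have h2 : ∫ s in a..(t : ℝ), M * (B * (s - a) ^ n)
      = M * B / (n + 1) * ((t : ℝ) - a) ^ (n + 1) := by
    rw [intervalIntegral.integral_const_mul, intervalIntegral.integral_const_mul,
      intervalIntegral.integral_comp_sub_right (fun x => x ^ n) a, integral_pow]
    simp
    ring
  exact h1.trans_eq h2

/-- The Volterra operator `u ↦ ∫ₐᵗ A(s) u(s) ds` on `C([a, b], E)`. -/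
noncomputable def volterra {E : Type*} [NormedAddCommGroup E] [NormedSpace ℝ E]
    {a b : ℝ} (hab : a ≤ b) (A : ℝ → E →L[ℝ] E) (hA : Continuous A) {M : ℝ}
    (hM : ∀ s ∈ Icc a b, ‖A s‖ ≤ M) : C(Icc a b, E) →L[ℝ] C(Icc a b, E) :=
  (volterraLinear hab A hA).mkContinuous (M * (b - a)) fun u => by
    have hM0 : 0 ≤ M := (norm_nonneg _).trans (hM a (left_mem_Icc.2 hab))
    rw [ContinuousMap.norm_le _ (by have := sub_nonneg.2 hab; positivity)]
    intro t
    refine (norm_volterraLinear_apply_le hab hA hM (B := ‖u‖) (n := 0)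
      (fun t => by simpa using u.norm_coe_le_norm t) t).trans ?_
    have h1 : (t : ℝ) - a ≤ b - a := sub_le_sub_right t.2.2 a
    have := mul_le_mul_of_nonneg_left h1 (mul_nonneg hM0 (norm_nonneg u))
    simp only [Nat.cast_zero, zero_add, div_one, pow_one]
    linarith

theorem norm_volterra_pow_apply_le {E : Type*} [NormedAddCommGroup E] [NormedSpace ℝ E]
    {a b : ℝ} (hab : a ≤ b) {A : ℝ → E →L[ℝ] E} (hA : Continuous A) {M : ℝ}
    (hM : ∀ s ∈ Icc a b, ‖A s‖ ≤ M) (u : C(Icc a b, E)) (n : ℕ) (t : Icc a b) :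
    ‖(volterra hab A hA hM ^ n) u t‖ ≤ M ^ n * ‖u‖ / n.factorial * ((t : ℝ) - a) ^ n := by
  induction n generalizing t with
  | zero => simpa using u.norm_coe_le_norm t
  | succ n ih =>
    rw [pow_succ']
    refine (norm_volterraLinear_apply_le hab hA hM ih t).trans_eq ?_
    rw [Nat.factorial_succ]
    push_cast
    field_simp
    ring

/-- A linear integral equation `u(t) = F(t) + ∫ₐᵗ A(s) u(s) ds` is solvable on `[a, b]`, with a
solution depending linearly on `F`. -/
theorem exists_linear_volterra_resolvent {E : Type*} [NormedAddCommGroup E] [NormedSpace ℝ E]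
    [CompleteSpace E] {a b : ℝ} (hab : a ≤ b) {A : ℝ → E →L[ℝ] E} (hA : Continuous A) :
    ∃ R : C(Icc a b, E) →ₗ[ℝ] C(Icc a b, E), ∀ (F : C(Icc a b, E)) (t : Icc a b),
      R F t = F t + ∫ s in a..(t : ℝ), A s (R F (projIcc a b hab s)) := by
  obtain ⟨M, hM⟩ := isCompact_Icc.exists_bound_of_continuousOn (hA.continuousOn (s := Icc a b))
  have hM0 : 0 ≤ M := (norm_nonneg _).trans (hM a (left_mem_Icc.2 hab))
  have hba : 0 ≤ b - a := sub_nonneg.2 hab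
  set V := volterra hab A hA hM with hV
  -- `V` need not be a contraction, but some power is, since `‖V ^ n‖ ≤ (M (b - a)) ^ n / n!`.
  obtain ⟨n, hn⟩ := ((FloorSemiring.tendsto_pow_div_factorial_atTop
    (M * (b - a))).eventually_lt_const one_pos).exists
  have hVn : ‖V ^ n‖ < 1 := by
    refine lt_of_le_of_lt (ContinuousLinearMap.opNorm_le_bound _ (by positivity) fun u => ?_) hn
    rw [ContinuousMap.norm_le _ (by positivity)]
    intro t
    refine (norm_volterra_pow_apply_le hab hA hM u n t).trans ?_
    have h1 : ((t : ℝ) - a) ^ n ≤ (b - a) ^ n :=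
      pow_le_pow_left₀ (sub_nonneg.2 t.2.1) (sub_le_sub_right t.2.2 a) n
    refine (mul_le_mul_of_nonneg_left h1 (by positivity)).trans_eq ?_
    rw [mul_pow]
    ring
  obtain ⟨W, hW⟩ :=
    (isUnit_one_sub_of_norm_lt_one (R := C(Icc a b, E) →L[ℝ] C(Icc a b, E)) hVn).exists_right_inv
  -- The geometric sum telescopes: `(1 - V) ∑ V ^ i = 1 - V ^ n`, and `W` is a right inverse of the
  -- latter.
  set R := (∑ i ∈ Finset.range n, V ^ i) * W with hR
  have hinv : (1 - V) * R = 1 := by rw [hR, ← mul_assoc, mul_neg_geom_sum, hW]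
  refine ⟨R.toLinearMap, fun F t => ?_⟩
  have h2 : R F - V (R F) = F := by
    simpa using congrArg (fun T : C(Icc a b, E) →L[ℝ] C(Icc a b, E) => T F) hinv
  exact congrArg (fun w : C(Icc a b, E) => w t) (sub_eq_iff_eq_add.1 h2)

/-! ### Uniqueness by the energy identity -/

theorem eq_zero_on_Icc_of_eq_zero_on_Ioo {a b : ℝ} (hab : a < b) {f : ℝ → ℝ}
    (hf : ContinuousOn f (Icc a b)) (h0 : ∀ t ∈ Ioo a b, f t = 0) : ∀ t ∈ Icc a b, f t = 0 := by
  have h1 : EqOn f (fun _ => 0) (Ioo a b) := h0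
  exact h1.of_subset_closure hf continuousOn_const Ioo_subset_Icc_self (closure_Ioo hab.ne).ge

/-- Uniqueness for the homogeneous radial boundary value problem, by the energy identity. -/
theorem eq_zero_of_homogeneous_radial_bvp {a b lam mu κ : ℝ} (ha : 0 < a) (hab : a < b)
    (hmu : 0 < mu) (hlm : 0 < 3 * lam + 2 * mu) (hκ : 0 < κ) {Y Z Y₁ Z₁ : ℝ → ℝ}
    (cY : ContinuousOn Y (Icc a b)) (cZ : ContinuousOn Z (Icc a b))
    (cY₁ : ContinuousOn Y₁ (Icc a b)) (cZ₁ : ContinuousOn Z₁ (Icc a b))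
    (dY : ∀ t ∈ Ioo a b, HasDerivAt Y (Y₁ t) t) (dZ : ∀ t ∈ Ioo a b, HasDerivAt Z (Z₁ t) t)
    (dY₁ : ∀ t ∈ Ioo a b, HasDerivAt Y₁ (-(Y₁ t / t) + Y t / t ^ 2
      + mu / (lam + 2 * mu) * κ ^ 2 * Y t - (lam + mu) / (lam + 2 * mu) * κ * Z₁ t) t)
    (dZ₁ : ∀ t ∈ Ioo a b, HasDerivAt Z₁ (-(Z₁ t / t) + (lam + 2 * mu) / mu * κ ^ 2 * Z t
      + (lam + mu) / mu * κ * (Y₁ t + Y t / t)) t)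
    (bY : ∀ t ∈ ({a, b} : Set ℝ), (lam + 2 * mu) * Y₁ t + lam / t * Y t + lam * κ * Z t = 0)
    (bZ : ∀ t ∈ ({a, b} : Set ℝ), Z₁ t - κ * Y t = 0) :
    ∀ t ∈ Icc a b, Y t = 0 ∧ Z t = 0 := by
  have hL : 0 < lam + 2 * mu := by linarith
  -- `Φ` is the radius times the work of the boundary tractions; its derivative `W` is the radius
  -- times the elastic energy density.
  set Φ : ℝ → ℝ := fun t => (t * ((lam + 2 * mu) * Y₁ t) + lam * Y t + lam * κ * (t * Z t)) * Y t
    + mu * (t * (Z₁ t - κ * Y t)) * Z t with hΦ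
  set W : ℝ → ℝ := fun t => t * (lam * (Y₁ t + Y t / t + κ * Z t) ^ 2
    + 2 * mu * (Y₁ t ^ 2 + (Y t / t) ^ 2 + (κ * Z t) ^ 2) + mu * (Z₁ t - κ * Y t) ^ 2) with hW
  have cΦ : ContinuousOn Φ (Icc a b) := by fun_prop
  have dΦ : ∀ t ∈ Ioo a b, HasDerivAt Φ (W t) t := by
    intro t ht
    have t0 : 0 < t := ha.trans ht.1
    have hid := hasDerivAt_id' t
    have h1 := ((((hid.mul ((dY₁ t ht).const_mul (lam + 2 * mu))).add
      ((dY t ht).const_mul lam)).add ((hid.mul (dZ t ht)).const_mul (lam * κ))).mul (dY t ht)).add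
      (((hid.mul ((dZ₁ t ht).sub ((dY t ht).const_mul κ))).const_mul mu).mul (dZ t ht))
    refine h1.congr_deriv ?_
    simp only [hW, Pi.add_apply, Pi.mul_apply, Pi.sub_apply]
    field_simp
    ring
  have W0 : ∀ t ∈ Ioo a b, 0 ≤ W t ∧ (W t = 0 → Y t = 0 ∧ Z t = 0) := by
    intro t ht
    have t0 : 0 < t := ha.trans ht.1
    -- Splitting into trace and deviatoric parts shows that `3 * lam + 2 * mu > 0` and `mu > 0`
    -- suffice, even for negative `lam`.
    have key : ∀ x y z : ℝ, 3 * (lam * (x + y + z) ^ 2 + 2 * mu * (x ^ 2 + y ^ 2 + z ^ 2))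
        = (3 * lam + 2 * mu) * (x + y + z) ^ 2
          + 2 * mu * ((x - y) ^ 2 + (y - z) ^ 2 + (z - x) ^ 2) := fun x y z => by ring
    have k := key (Y₁ t) (Y t / t) (κ * Z t)
    have n1 : 0 ≤ (3 * lam + 2 * mu) * (Y₁ t + Y t / t + κ * Z t) ^ 2 := by positivity
    have n2 : 0 ≤ 2 * mu * ((Y₁ t - Y t / t) ^ 2 + (Y t / t - κ * Z t) ^ 2
      + (κ * Z t - Y₁ t) ^ 2) := by positivity
    have n3 : 0 ≤ mu * (Z₁ t - κ * Y t) ^ 2 := by positivity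
    refine ⟨mul_nonneg t0.le (by linarith), fun h => ?_⟩
    have h' := (mul_eq_zero.1 h).resolve_left t0.ne'
    have m1 : (3 * lam + 2 * mu) * (Y₁ t + Y t / t + κ * Z t) ^ 2 = 0 := by linarith
    have m2 : 2 * mu * ((Y₁ t - Y t / t) ^ 2 + (Y t / t - κ * Z t) ^ 2
      + (κ * Z t - Y₁ t) ^ 2) = 0 := by linarith
    have s1 := pow_eq_zero_iff two_ne_zero |>.1 ((mul_eq_zero.1 m1).resolve_left hlm.ne')
    have s2 := (mul_eq_zero.1 m2).resolve_left (by positivity)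
    have s3 : Y₁ t - Y t / t = 0 := by
      apply pow_eq_zero_iff two_ne_zero |>.1
      nlinarith [sq_nonneg (Y₁ t - Y t / t), sq_nonneg (Y t / t - κ * Z t),
        sq_nonneg (κ * Z t - Y₁ t)]
    have s4 : Y t / t - κ * Z t = 0 := by
      apply pow_eq_zero_iff two_ne_zero |>.1
      nlinarith [sq_nonneg (Y₁ t - Y t / t), sq_nonneg (Y t / t - κ * Z t),
        sq_nonneg (κ * Z t - Y₁ t)]
    have y0 : Y t / t = 0 := by linarith
    have z0 : κ * Z t = 0 := by linarith
    exact ⟨(div_eq_zero_iff.1 y0).resolve_right t0.ne', (mul_eq_zero.1 z0).resolve_left hκ.ne'⟩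
  have Φend : ∀ t ∈ ({a, b} : Set ℝ), 0 < t → Φ t = 0 := by
    intro t ht t0
    have e : t * ((lam + 2 * mu) * Y₁ t) + lam * Y t + lam * κ * (t * Z t)
        = t * ((lam + 2 * mu) * Y₁ t + lam / t * Y t + lam * κ * Z t) := by
      field_simp
    simp only [hΦ]
    rw [e, bY t ht, bZ t ht]
    ring
  have Φa := Φend a (by simp) ha
  have Φb := Φend b (by simp) (ha.trans hab)
  -- A nondecreasing function with zero end values is zero, so its derivative `W` vanishes as well.
  have mono : MonotoneOn Φ (Icc a b) := by
    apply monotoneOn_of_deriv_nonneg (convex_Icc a b) cΦ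
    · intro t ht
      rw [interior_Icc] at ht
      exact (dΦ t ht).differentiableAt.differentiableWithinAt
    · intro t ht
      rw [interior_Icc] at ht
      rw [(dΦ t ht).deriv]
      exact (W0 t ht).1
  have Φ0 : ∀ t ∈ Icc a b, Φ t = 0 := fun t ht => le_antisymm
    (Φb ▸ mono ht (right_mem_Icc.2 hab.le) ht.2) (Φa ▸ mono (left_mem_Icc.2 hab.le) ht ht.1)
  have YZ : ∀ t ∈ Ioo a b, Y t = 0 ∧ Z t = 0 := by
    intro t ht
    refine (W0 t ht).2 ((dΦ t ht).unique ?_)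
    refine (hasDerivAt_const t (0 : ℝ)).congr_of_eventuallyEq ?_
    filter_upwards [isOpen_Ioo.mem_nhds ht] with s hs using Φ0 s (Ioo_subset_Icc_self hs)
  exact fun t ht => ⟨eq_zero_on_Icc_of_eq_zero_on_Ioo hab cY (fun s hs => (YZ s hs).1) t ht,
    eq_zero_on_Icc_of_eq_zero_on_Ioo hab cZ (fun s hs => (YZ s hs).2) t ht⟩

/-- The forcing cancels in the difference, whose second weak derivatives thus become continuous
expressions in lower-order terms; the difference is a classical homogeneous solution. -/
theorem IsRadialSolution.ae_eq {a b h lam mu : ℝ} {k : ℕ} (ha : 0 < a) (hab : a < b)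
    (hmu : 0 < mu) (hlm : 0 < 3 * lam + 2 * mu) (hh : 0 < h) (hk : 0 < k) {Ψ Y Z Y' Z' : ℝ → ℝ}
    (hs : IsRadialSolution a b h lam mu k Ψ Y Z) (hs' : IsRadialSolution a b h lam mu k Ψ Y' Z') :
    Y =ᵐ[volume.restrict (Ioo a b)] Y' ∧ Z =ᵐ[volume.restrict (Ioo a b)] Z' := by
  obtain ⟨Y₀, Y₁, Y₂, Z₀, Z₁, Z₂, ⟨cY, aY⟩, ⟨cZ, aZ⟩, cY₁, cZ₁, wY, wY₁, wZ, wZ₁, eY, eZ, bY, bZ⟩ := hs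
  obtain ⟨P₀, P₁, P₂, Q₀, Q₁, Q₂, ⟨cP, aP⟩, ⟨cQ, aQ⟩, cP₁, cQ₁, wP, wP₁, wQ, wQ₁, eP, eQ, bP, bQ⟩ :=
    hs'
  have hk' : (0 : ℝ) < k := Nat.cast_pos.2 hk
  have hL : 0 < lam + 2 * mu := by linarith
  have hκ : 0 < Real.pi * k / h := by have := Real.pi_pos; positivity
  have hκ2 : Real.pi ^ 2 * (k : ℝ) ^ 2 / h ^ 2 = (Real.pi * k / h) ^ 2 := by ring
  rw [hκ2] at eY eZ eP eQ
  set κ := Real.pi * k / h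
  have ne : ∀ t ∈ Icc a b, t ≠ 0 := fun t ht => (ha.trans_le ht.1).ne'
  have ne2 : ∀ t ∈ Icc a b, t ^ 2 ≠ 0 := fun t ht => pow_ne_zero 2 (ne t ht)
  set y : ℝ → ℝ := fun t => Y₀ t - P₀ t with hy
  set z : ℝ → ℝ := fun t => Z₀ t - Q₀ t with hz
  set y₁ : ℝ → ℝ := fun t => Y₁ t - P₁ t with hy₁
  set z₁ : ℝ → ℝ := fun t => Z₁ t - Q₁ t with hz₁
  have cy : ContinuousOn y (Icc a b) := cY.sub cP
  have cz : ContinuousOn z (Icc a b) := cZ.sub cQ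
  have cy₁ : ContinuousOn y₁ (Icc a b) := cY₁.sub cP₁
  have cz₁ : ContinuousOn z₁ (Icc a b) := cZ₁.sub cQ₁
  have wy : HasWeakDerivOn a b y y₁ := (wY.sub wP).congr_ae
    (by filter_upwards [aY, aP] with t h1 h2; rw [h1, h2]) Filter.EventuallyEq.rfl
  have wz : HasWeakDerivOn a b z z₁ := (wZ.sub wQ).congr_ae
    (by filter_upwards [aZ, aQ] with t h1 h2; rw [h1, h2]) Filter.EventuallyEq.rfl
  have wy₁ : HasWeakDerivOn a b y₁ (fun t => -(y₁ t / t) + y t / t ^ 2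
      + mu / (lam + 2 * mu) * κ ^ 2 * y t - (lam + mu) / (lam + 2 * mu) * κ * z₁ t) := by
    refine (wY₁.sub wP₁).congr_ae Filter.EventuallyEq.rfl ?_
    filter_upwards [aY, aP, eY, eP] with t h1 h2 h3 h4
    simp only [hy, hy₁, hz₁, ← h1, ← h2]
    linear_combination h3 - h4
  have wz₁ : HasWeakDerivOn a b z₁ (fun t => -(z₁ t / t) + (lam + 2 * mu) / mu * κ ^ 2 * z t
      + (lam + mu) / mu * κ * (y₁ t + y t / t)) := by
    refine (wZ₁.sub wQ₁).congr_ae Filter.EventuallyEq.rfl ?_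
    filter_upwards [aY, aP, aZ, aQ, eZ, eQ] with t h1 h2 h3 h4 h5 h6
    simp only [hy, hy₁, hz, hz₁, ← h1, ← h2, ← h3, ← h4]
    linear_combination h5 - h6
  have key := eq_zero_of_homogeneous_radial_bvp ha hab hmu hlm hκ cy cz cy₁ cz₁
    (wy.hasDerivAt hab cy cy₁) (wz.hasDerivAt hab cz cz₁)
    (wy₁.hasDerivAt hab cy₁ (by fun_prop (disch := assumption)))
    (wz₁.hasDerivAt hab cz₁ (by fun_prop (disch := assumption)))
    (fun t ht => by simp only [hy, hy₁, hz]; linear_combination bY t ht - bP t ht)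
    (fun t ht => by simp only [hy, hz₁]; linear_combination bZ t ht - bQ t ht)
  constructor
  · filter_upwards [aY, aP, ae_restrict_mem measurableSet_Ioo] with t h1 h2 ht
    rw [h1, h2]
    exact sub_eq_zero.1 (key t (Ioo_subset_Icc_self ht)).1
  · filter_upwards [aZ, aQ, ae_restrict_mem measurableSet_Ioo] with t h1 h2 ht
    rw [h1, h2]
    exact sub_eq_zero.1 (key t (Ioo_subset_Icc_self ht)).2

/-! ### Existence by shooting for the first-order system -/

/-- The coefficient matrix of the radial system in the unknowns `(Y, Z, Y', Z')`; the radius is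
cut off below at `a`. -/
noncomputable def radialSystem (a lam mu κ t : ℝ) : (Fin 4 → ℝ) →L[ℝ] (Fin 4 → ℝ) :=
  LinearMap.toContinuousLinearMap (Matrix.toLin'
    !![0, 0, 1, 0;
       0, 0, 0, 1;
       1 / (max a t) ^ 2 + mu / (lam + 2 * mu) * κ ^ 2, 0, -(1 / max a t),
         -((lam + mu) / (lam + 2 * mu) * κ);
       (lam + mu) / mu * κ / max a t, (lam + 2 * mu) / mu * κ ^ 2, (lam + mu) / mu * κ,
         -(1 / max a t)])

theorem radialSystem_apply {a lam mu κ t : ℝ} (v : Fin 4 → ℝ) :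
    radialSystem a lam mu κ t v = ![v 2, v 3,
      (1 / (max a t) ^ 2 + mu / (lam + 2 * mu) * κ ^ 2) * v 0 - 1 / max a t * v 2
        - (lam + mu) / (lam + 2 * mu) * κ * v 3,
      (lam + mu) / mu * κ / max a t * v 0 + (lam + 2 * mu) / mu * κ ^ 2 * v 1
        + (lam + mu) / mu * κ * v 2 - 1 / max a t * v 3] := by
  ext i
  fin_cases i <;> simp [radialSystem, Matrix.mulVec, dotProduct, Fin.sum_univ_four] <;> ring

/-- The cutoff `max a t` avoids the singularity at radius zero, giving continuity on the whole line
as the Volterra theory demands. -/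
theorem continuous_radialSystem {a lam mu κ : ℝ} (ha : 0 < a) :
    Continuous (radialSystem a lam mu κ) := by
  have h1 : ∀ t, max a t ≠ 0 := fun t => (ha.trans_le (le_max_left a t)).ne'
  have h2 : ∀ t, max a t ^ 2 ≠ 0 := fun t => pow_ne_zero 2 (h1 t)
  rw [continuous_clm_apply]
  intro v
  simp only [radialSystem_apply]
  refine continuous_pi fun i => ?_
  fin_cases i <;> simp <;> fun_prop (disch := assumption)

/-- Only differentiability of `F` at the single point `x` is required, so a kink of `F` elsewhere is
harmless. -/
theorem hasDerivAt_IccExtend_of_volterra {E : Type*} [NormedAddCommGroup E] [NormedSpace ℝ E]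
    [CompleteSpace E] {a b : ℝ} (hab : a ≤ b) {A : ℝ → E →L[ℝ] E} (hA : Continuous A)
    {u : C(Icc a b, E)} {F : ℝ → E}
    (hu : ∀ t : Icc a b, u t = F t + ∫ s in a..(t : ℝ), A s (u (projIcc a b hab s)))
    {x : ℝ} (hx : x ∈ Ioo a b) {f : E} (hF : HasDerivAt F f x) :
    HasDerivAt (IccExtend hab u) (f + A x (IccExtend hab u x)) x := by
  have hc := continuous_volterra_integrand hab hA u
  have hd := hF.add (intervalIntegral.integral_hasDerivAt_right (hc.intervalIntegrable a x)
    hc.stronglyMeasurable.stronglyMeasurableAtFilter hc.continuousAt)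
  refine hd.congr_of_eventuallyEq ?_
  filter_upwards [isOpen_Ioo.mem_nhds hx] with y hy
  rw [IccExtend_of_mem hab _ (Ioo_subset_Icc_self hy), hu]
  rfl

/-- The boundary conditions of the radial system in the unknowns `(Y, Z, Y', Z')`. -/
noncomputable def radialBoundary {a b : ℝ} (hab : a ≤ b) (lam mu κ : ℝ) :
    C(Icc a b, Fin 4 → ℝ) →ₗ[ℝ] (Fin 4 → ℝ) where
  toFun w := ![
    (lam + 2 * mu) * w ⟨a, left_mem_Icc.2 hab⟩ 2 + lam / a * w ⟨a, left_mem_Icc.2 hab⟩ 0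
      + lam * κ * w ⟨a, left_mem_Icc.2 hab⟩ 1,
    w ⟨a, left_mem_Icc.2 hab⟩ 3 - κ * w ⟨a, left_mem_Icc.2 hab⟩ 0,
    (lam + 2 * mu) * w ⟨b, right_mem_Icc.2 hab⟩ 2 + lam / b * w ⟨b, right_mem_Icc.2 hab⟩ 0
      + lam * κ * w ⟨b, right_mem_Icc.2 hab⟩ 1,
    w ⟨b, right_mem_Icc.2 hab⟩ 3 - κ * w ⟨b, right_mem_Icc.2 hab⟩ 0]
  map_add' u v := by
    ext i
    fin_cases i <;> simp <;> ring
  map_smul' c u := by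
    ext i
    fin_cases i <;> simp <;> ring

theorem radialBoundary_eq_zero {a b : ℝ} {hab : a ≤ b} {lam mu κ : ℝ} {w : C(Icc a b, Fin 4 → ℝ)}
    (h : radialBoundary hab lam mu κ w = 0) :
    (∀ t ∈ ({a, b} : Set ℝ), (lam + 2 * mu) * IccExtend hab w t 2 + lam / t * IccExtend hab w t 0
      + lam * κ * IccExtend hab w t 1 = 0) ∧
    ∀ t ∈ ({a, b} : Set ℝ), IccExtend hab w t 3 - κ * IccExtend hab w t 0 = 0 := by
  have h0 := congrFun h 0
  have h1 := congrFun h 1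
  have h2 := congrFun h 2
  have h3 := congrFun h 3
  simp only [radialBoundary, LinearMap.coe_mk, AddHom.coe_mk] at h0 h1 h2 h3
  constructor <;> rintro t (rfl | rfl)
  · rw [IccExtend_of_mem hab _ (left_mem_Icc.2 hab)]; exact h0
  · rw [IccExtend_of_mem hab _ (right_mem_Icc.2 hab)]; exact h2
  · rw [IccExtend_of_mem hab _ (left_mem_Icc.2 hab)]; exact h1
  · rw [IccExtend_of_mem hab _ (right_mem_Icc.2 hab)]; exact h3

/-- Solvability of the radial system with step forcing `c` on `(a, ε)` and `0` on `(ε, b)`. -/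
theorem exists_radialSystem_solution {a b lam mu κ : ℝ} (ha : 0 < a) (hab : a < b)
    (hmu : 0 < mu) (hlm : 0 < 3 * lam + 2 * mu) (hκ : 0 < κ) (ε c : ℝ) :
    ∃ v : ℝ → Fin 4 → ℝ, Continuous v ∧
      (∀ t ∈ Ioo a b \ {ε}, HasDerivAt v
        (Pi.single 3 ((Iio ε).indicator (fun _ => c) t) + radialSystem a lam mu κ t (v t)) t) ∧
      (∀ t ∈ ({a, b} : Set ℝ), (lam + 2 * mu) * v t 2 + lam / t * v t 0 + lam * κ * v t 1 = 0) ∧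
      ∀ t ∈ ({a, b} : Set ℝ), v t 3 - κ * v t 0 = 0 := by
  have hL : lam + 2 * mu ≠ 0 := by
    have : 0 < lam + 2 * mu := by linarith
    exact this.ne'
  have hA := continuous_radialSystem (lam := lam) (mu := mu) (κ := κ) ha
  obtain ⟨R, hR⟩ := exists_linear_volterra_resolvent hab.le hA
  set C : (Fin 4 → ℝ) →ₗ[ℝ] C(Icc a b, Fin 4 → ℝ) :=
    { toFun := ContinuousMap.const _
      map_add' := fun _ _ => rfl
      map_smul' := fun _ _ => rfl } 
  set T := radialBoundary hab.le lam mu κ ∘ₗ R ∘ₗ C with hT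
  have inj : Function.Injective T := by
    rw [← LinearMap.ker_eq_bot, LinearMap.ker_eq_bot']
    intro x hx
    obtain ⟨b1, b2⟩ := radialBoundary_eq_zero (w := R (C x)) hx
    set v := IccExtend hab.le (R (C x)) with hv
    have hvc : Continuous v := (R (C x)).continuous.Icc_extend'
    have hd : ∀ t ∈ Ioo a b, HasDerivAt v (radialSystem a lam mu κ t (v t)) t := fun t ht => by
      simpa using hasDerivAt_IccExtend_of_volterra hab.le hA (F := fun _ => x) (hR (C x)) ht
        (hasDerivAt_const t x)
    have hd' : ∀ i, ∀ t ∈ Ioo a b, HasDerivAt (fun t => v t i)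
        (radialSystem a lam mu κ t (v t) i) t := fun i t ht => hasDerivAt_pi.1 (hd t ht) i
    have hci : ∀ i, Continuous fun t => v t i := fun i => (continuous_apply i).comp hvc
    have hz := eq_zero_of_homogeneous_radial_bvp ha hab hmu hlm hκ (hci 0).continuousOn
      (hci 1).continuousOn (hci 2).continuousOn (hci 3).continuousOn
      (fun t ht => (hd' 0 t ht).congr_deriv (by simp [radialSystem_apply]))
      (fun t ht => (hd' 1 t ht).congr_deriv (by simp [radialSystem_apply]))
      (fun t ht => (hd' 2 t ht).congr_deriv (by
        simp only [radialSystem_apply, max_eq_right ht.1.le, Matrix.cons_val]; ring))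
      (fun t ht => (hd' 3 t ht).congr_deriv (by
        simp only [radialSystem_apply, max_eq_right ht.1.le, Matrix.cons_val]; ring))
      b1 b2
    have hmem : a ∈ Icc a b := left_mem_Icc.2 hab.le
    have hva : v a = x := by
      rw [hv, IccExtend_of_mem hab.le _ hmem, hR]
      simp only [intervalIntegral.integral_same, add_zero]
      rfl
    obtain ⟨z0, z1⟩ := hz a hmem
    -- Once `Y` and `Z` vanish at `a`, the boundary conditions there force `Y'` and `Z'` to vanish
    -- too, as `lam + 2 * mu ≠ 0`.
    have z2 := b1 a (by simp)
    have z3 := b2 a (by simp)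
    rw [hva] at z0 z1 z2 z3
    rw [z0, z1] at z2
    rw [z0] at z3
    have z2' : x 2 = 0 := by simpa [hL] using z2
    ext i
    fin_cases i
    · exact z0
    · exact z1
    · exact z2'
    · simpa using z3
  have surj : Function.Surjective T := LinearMap.injective_iff_surjective.1 inj
  -- A continuous primitive of the step forcing, with its kink at `ε`. Its nonzero value at `a` does
  -- no harm, because the initial data are still free.
  set G : ℝ → Fin 4 → ℝ := fun t => Pi.single 3 (c * min t ε) with hG
  have hGc : Continuous G := by
    refine continuous_pi fun i => ?_
    fin_cases i <;> simp [hG] <;> fun_prop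
  set g : C(Icc a b, Fin 4 → ℝ) := ⟨fun t => G t, hGc.comp continuous_subtype_val⟩ with hg
  -- Initial data whose homogeneous solution cancels the boundary defect of `R g`.
  obtain ⟨x, hx⟩ := surj (-radialBoundary hab.le lam mu κ (R g))
  have hb : radialBoundary hab.le lam mu κ (R (C x + g)) = 0 := by
    rw [map_add, map_add]
    change T x + _ = 0
    rw [hx, neg_add_cancel]
  obtain ⟨b1, b2⟩ := radialBoundary_eq_zero hb
  refine ⟨IccExtend hab.le (R (C x + g)), (R (C x + g)).continuous.Icc_extend', ?_, b1, b2⟩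
  intro t ht
  refine hasDerivAt_IccExtend_of_volterra hab.le hA (F := fun t => x + G t) (hR (C x + g)) ht.1 ?_
  refine HasDerivAt.const_add x ?_
  have hte : t ≠ ε := ht.2
  have hmin : HasDerivAt (fun t => c * min t ε) ((Iio ε).indicator (fun _ => c) t) t := by
    rcases lt_or_gt_of_ne hte with h | h
    · rw [indicator_of_mem (mem_Iio.2 h)]
      have := (hasDerivAt_id' t).const_mul c
      rw [mul_one] at this
      refine this.congr_of_eventuallyEq ?_
      filter_upwards [isOpen_Iio.mem_nhds h] with s hs
      rw [min_eq_left (le_of_lt hs)]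
    · rw [indicator_of_notMem (by simpa using h.le)]
      refine (hasDerivAt_const t (c * ε)).congr_of_eventuallyEq ?_
      filter_upwards [isOpen_Ioi.mem_nhds h] with s hs
      rw [min_eq_right (le_of_lt hs)]
  rw [hasDerivAt_pi]
  intro i
  fin_cases i
  · simpa [hG] using hasDerivAt_const t (0 : ℝ)
  · simpa [hG] using hasDerivAt_const t (0 : ℝ)
  · simpa [hG] using hasDerivAt_const t (0 : ℝ)
  · simpa [hG] using hmin

/-! ### Passage to the Sobolev formulation and conclusion -/

theorem memLp_two_of_continuous {f : ℝ → ℝ} (hf : Continuous f) (a b : ℝ) :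
    MemLp f 2 (volume.restrict (Ioo a b)) := by
  obtain ⟨C, hC⟩ := (isCompact_Icc (a := a) (b := b)).exists_bound_of_continuousOn hf.continuousOn
  refine MemLp.of_bound hf.aestronglyMeasurable C ?_
  filter_upwards [ae_restrict_mem measurableSet_Ioo] with x hx
  exact hC x (Ioo_subset_Icc_self hx)

theorem exists_isRadialSolution {a b h lam mu ε c : ℝ} {k : ℕ} (ha : 0 < a) (hab : a < b)
    (hmu : 0 < mu) (hlm : 0 < 3 * lam + 2 * mu) (hh : 0 < h) (hk : 0 < k) {Ψ : ℝ → ℝ}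
    (hΨ : ∀ t ∈ Ioo a b, Ψ t = (Iio ε).indicator (fun _ => c) t) :
    ∃ u : H1Interval a b × H1Interval a b,
      IsRadialSolution a b h lam mu k Ψ (u.1 : L2Interval a b) (u.2 : L2Interval a b) := by
  have hk' : (0 : ℝ) < k := Nat.cast_pos.2 hk
  have hL : 0 < lam + 2 * mu := by linarith
  have hκ : 0 < Real.pi * k / h := by have := Real.pi_pos; positivity
  have hκ2 : Real.pi ^ 2 * (k : ℝ) ^ 2 / h ^ 2 = (Real.pi * k / h) ^ 2 := by ring
  -- Solved for the second derivative of `Z`, the equation carries the forcing with factor `-(1 /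
  -- mu)`.
  obtain ⟨v, hv, hd, b1, b2⟩ :=
    exists_radialSystem_solution ha hab hmu hlm hκ ε (-(1 / mu) * c)
  unfold IsRadialSolution
  rw [hκ2]
  set κ := Real.pi * k / h
  have hci : ∀ i, Continuous fun t => v t i := fun i => (continuous_apply i).comp hv
  have hAv : ∀ i, Continuous fun t => radialSystem a lam mu κ t (v t) i := fun i =>
    (continuous_apply i).comp ((continuous_radialSystem ha).clm_apply hv)
  have hw : ∀ i, HasWeakDerivOn a b (fun t => v t i) (fun t =>
      (Pi.single 3 ((Iio ε).indicator (fun _ => -(1 / mu) * c) t) : Fin 4 → ℝ) i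
        + radialSystem a lam mu κ t (v t) i) := by
    intro i
    refine hasWeakDerivOn_of_hasDerivAt hab (countable_singleton ε) (hci i).continuousOn
      (fun t ht => hasDerivAt_pi.1 (hd t ht) i) (Integrable.add ?_
        (hAv i).continuousOn.integrableOn_Icc)
    by_cases hi : i = 3
    · subst hi
      simp only [Pi.single_eq_same]
      exact continuousOn_const.integrableOn_Icc.indicator measurableSet_Iio
    · simp only [Pi.single_eq_of_ne hi]
      exact integrable_zero _ _ _
  have w0 : HasWeakDerivOn a b (fun t => v t 0) (fun t => v t 2) := by
    simpa [radialSystem_apply] using hw 0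
  have w1 : HasWeakDerivOn a b (fun t => v t 1) (fun t => v t 3) := by
    simpa [radialSystem_apply] using hw 1
  have m : ∀ i, MemLp (fun t => v t i) 2 (volume.restrict (Ioo a b)) := fun i =>
    memLp_two_of_continuous (hci i) a b
  have e : ∀ i, (m i).toLp =ᵐ[volume.restrict (Ioo a b)] fun t => v t i := fun i =>
    (m i).coeFn_toLp
  refine ⟨(⟨(m 0).toLp, (m 2).toLp, w0.congr_ae (e 0).symm (e 2).symm⟩,
    ⟨(m 1).toLp, (m 3).toLp, w1.congr_ae (e 1).symm (e 3).symm⟩),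
    fun t => v t 0, fun t => v t 2, _, fun t => v t 1, fun t => v t 3, _,
    ⟨(hci 0).continuousOn, e 0⟩, ⟨(hci 1).continuousOn, e 1⟩, (hci 2).continuousOn,
    (hci 3).continuousOn, w0.congr_ae (e 0).symm Filter.EventuallyEq.rfl, hw 2,
    w1.congr_ae (e 1).symm Filter.EventuallyEq.rfl, hw 3, ?_, ?_, b1, b2⟩
  · filter_upwards [e 0, e 1, ae_restrict_mem measurableSet_Ioo] with t h0 h1 ht
    simp only [h0, radialSystem_apply, max_eq_right ht.1.le, Matrix.cons_val]
    simp
    ring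
  · filter_upwards [e 0, e 1, ae_restrict_mem measurableSet_Ioo] with t h0 h1 ht
    simp only [h0, h1, hΨ t ht, radialSystem_apply, max_eq_right ht.1.le, Matrix.cons_val,
      Pi.single_eq_same]
    have hi : (Iio ε).indicator (fun _ => -(1 / mu) * c) t
        = -(1 / mu) * (Iio ε).indicator (fun _ => c) t := by
      by_cases hte : t ∈ Iio ε <;> simp [hte]
    rw [hi]
    ring

theorem PsiRadial_eq_indicator {a ε p h t : ℝ} {k : ℕ} (ha : 0 < a) (haε : a < ε) (hat : a < t) :
    PsiRadial a ε p h k t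
      = (Iio ε).indicator (fun _ => if Odd k then (-1) ^ ((k + 1) / 2) * (4 / h) * p else 0) t := by
  have t0 := ha.trans hat
  have h1 : a ^ 2 ≤ t ^ 2 := pow_le_pow_left₀ ha.le hat.le 2
  have h2 : t ^ 2 < ε ^ 2 ↔ t < ε := pow_lt_pow_iff_left₀ t0.le (ha.trans haε).le two_ne_zero
  by_cases hk : Odd k <;> by_cases ht : t < ε <;>
    simp [PsiRadial, PsiForce, chiLoad, hk, ht, h1, h2]

theorem lemma3p6 (E ν a b ε h p : ℝ) (hE : 0 < E) (hν₁ : -1 < ν) (hν₂ : ν < 1 / 2)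
    (ha : 0 < a) (haε : a < ε) (hεb : ε < b) (hh : 0 < h) (hp : 0 ≤ p)
    (k : ℕ) (hk : Odd k) :
    ∃! u : H1Interval a b × H1Interval a b,
      IsRadialSolution a b h (lameLambda E ν) (lameMu E ν) k (PsiRadial a ε p h k)
        (u.1 : L2Interval a b) (u.2 : L2Interval a b) := by
  have hν : 0 < 1 + ν := by linarith
  have hν' : 0 < 1 - 2 * ν := by linarith
  have hmu : 0 < lameMu E ν := div_pos hE (by positivity)
  -- For `ν < 0` the first Lamé constant is negative; this combination stays positive on the whole
  -- range of `ν`.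
  have hlm : 0 < 3 * lameLambda E ν + 2 * lameMu E ν := by
    have e : 3 * lameLambda E ν + 2 * lameMu E ν = E / (1 - 2 * ν) := by
      rw [lameLambda, lameMu, mul_div_assoc', mul_div_assoc',
        div_add_div _ _ (by positivity) (by positivity), div_eq_div_iff (by positivity) hν'.ne']
      ring
    rw [e]
    positivity
  have hab := haε.trans hεb
  obtain ⟨u, hu⟩ := exists_isRadialSolution ha hab hmu hlm hh hk.pos
    (fun t ht => PsiRadial_eq_indicator (ε := ε) (p := p) (h := h) (k := k) ha haε ht.1)
  refine ⟨u, hu, fun w hw => ?_⟩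
  obtain ⟨h1, h2⟩ := IsRadialSolution.ae_eq ha hab hmu hlm hh hk.pos hw hu
  exact Prod.ext (Subtype.ext (Lp.ext h1)) (Subtype.ext (Lp.ext h2))
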